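/- Let $p\in\mathbb N_0$, $N_t=p+1$, $\tau>0$, $h>0$, $t_n=n\tau$, let $\psi_1,\dots,\psi_{N_t}$ be any basis of the real polynomials of degree at most $p$, and put $\psi_\ell^n(t)=\psi_\ell(t-t_{n-1})$ on the time interval $(t_{n-1},t_n)$. Define the real $N_t\times N_t$ matrices $$K_\tau[k,\ell]=-\int_{t_{n-1}}^{t_n}\psi_\ell^n\,\partial_t\psi_k^n\,\mathrm dt+\psi_\ell^n(t_n)\psi_k^n(t_n),\qquad M_\tau[k,\ell]=\int_{t_{n-1}}^{t_n}\psi_\ell^n\psi_k^n\,\mathrm dt,\qquad N_\tau[k,\ell]=\psi_\ell^{n-1}(t_{n-1})\,\psi_k^n(t_{n-1})$$ (they do not depend on $n$). For $\theta_x,\theta_t,\omega_t\in\mathbb R$ let $\beta(\theta_x)=6\,\frac{1-\cos\theta_x}{2+\cos\theta_x}$, $\mu=\tau h^{-2}$, and consider the symbol of the damped block Jacobi smoother $$\hat{\mathcal S}_{\tau,h}(\theta_x,\theta_t)=(1-\omega_t)I+\omega_te^{-\mathrm i\theta_t}\bigl(K_\tau+h^{-2}\beta(\theta_x)M_\tau\bigr)^{-1}N_\tau\in\mathbb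 C^{N_t\times N_t}.$$ Let $R=P/Q$ be the $(p,p+1)$ subdiagonal Padé approximation of $e^z$, that is, $P,Q$ are real polynomials with $\deg P\le p$, $\deg Q\le p+1$, $Q(0)=1$ and $e^zQ(z)-P(z)=O(z^{2p+2})$ as $z\to0$ (such a pair exists and is unique). Then $K_\tau+h^{-2}\beta(\theta_x)M_\tau$ is invertible and $Q(-\mu\beta(\theta_x))\ne0$, so that the symbol and $\alpha=\alpha(\theta_x,\mu):=R(-\mu\beta(\theta_x))$ are well defined; the quantity $(1-\omega_t)^2+2\omega_t(1-\omega_t)\alpha\cos\theta_t+\alpha^2\omega_t^2$ is nonnegative, and we write $\hat{\mathcal S}(\omega_t,\alpha,\theta_t)\ge0$ for its square root: $$\bigl(\hat{\mathcal S}(\omega_t,\alpha,\theta_t)\bigr)^2=(1-\omega_t)^2+2\omega_t(1-\omega_t)\,\alpha\cos\theta_t+\alpha^2\omega_t^2 .$$ If $p\ge1$, the spectral radius of the symbol is $$\varrho\bigl(\hat{\mathcal S}_{\tau,h}(\theta_x,\theta_t)\bigr)=\max\bigl\{|1-\omega_t|,\ \hat{\mathcal S}(\omega_t,\alpha(\theta_x,\mu),\theta_t)\bigr\}.$$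 If $p=0$, where the symbol is a scalar, it is $$\varrho\bigl(\hat{\mathcal S}_{\tau,h}(\theta_x,\theta_t)\bigr)=\hat{\mathcal S}(\omega_t,\alpha(\theta_x,\mu),\theta_t).$$ -/

import Mathlib

open scoped Polynomial

noncomputable section

namespace SpaceTimeMG

/-- The time node `t_n = n τ`, for `n ∈ ℤ`. -/
def node (τ : ℝ) (n : ℤ) : ℝ := n * τ

/-- The basis functions `ψ_ℓ^n` of the polynomials of degree at most `p` on the `n`-th time
interval `(t_{n-1}, t_n)`: the translates `ψ_ℓ^n (t) = ψ_ℓ (t - t_{n-1})` of one fixed (but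
arbitrary) basis `ψ` of the real polynomials of degree at most `p`. -/
def timeBasis {p : ℕ} (ψ : Module.Basis (Fin (p + 1)) ℝ (Polynomial.degreeLT ℝ (p + 1)))
    (τ : ℝ) (n : ℤ) (l : Fin (p + 1)) (t : ℝ) : ℝ :=
  (ψ l : ℝ[X]).eval (t - node τ (n - 1))

/-- `K_τ[k, ℓ] = - ∫_{t_{n-1}}^{t_n} ψ_ℓ^n ∂_t ψ_k^n + ψ_ℓ^n (t_n) ψ_k^n (t_n)`. -/
def timeStiffness {p : ℕ} (ψ : Module.Basis (Fin (p + 1)) ℝ (Polynomial.degreeLT ℝ (p + 1)))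
    (τ : ℝ) (n : ℤ) : Matrix (Fin (p + 1)) (Fin (p + 1)) ℝ :=
  Matrix.of fun k l =>
    -(∫ t in (node τ (n - 1))..(node τ n), timeBasis ψ τ n l t * deriv (timeBasis ψ τ n k) t)
      + timeBasis ψ τ n l (node τ n) * timeBasis ψ τ n k (node τ n)

/-- `M_τ[k, ℓ] = ∫_{t_{n-1}}^{t_n} ψ_ℓ^n ψ_k^n`. -/
def timeMass {p : ℕ} (ψ : Module.Basis (Fin (p + 1)) ℝ (Polynomial.degreeLT ℝ (p + 1)))
    (τ : ℝ) (n : ℤ) : Matrix (Fin (p + 1)) (Fin (p + 1)) ℝ :=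
  Matrix.of fun k l =>
    ∫ t in (node τ (n - 1))..(node τ n), timeBasis ψ τ n l t * timeBasis ψ τ n k t

/-- `N_τ[k, ℓ] = ψ_ℓ^{n-1} (t_{n-1}) ψ_k^n (t_{n-1})`. -/
def timeCoupling {p : ℕ} (ψ : Module.Basis (Fin (p + 1)) ℝ (Polynomial.degreeLT ℝ (p + 1)))
    (τ : ℝ) (n : ℤ) : Matrix (Fin (p + 1)) (Fin (p + 1)) ℝ :=
  Matrix.of fun k l =>
    timeBasis ψ τ (n - 1) l (node τ (n - 1)) * timeBasis ψ τ n k (node τ (n - 1))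

/-- `β(θ_x) = 6 (1 - cos θ_x) / (2 + cos θ_x)`. -/
def beta (θx : ℝ) : ℝ := 6 * ((1 - Real.cos θx) / (2 + Real.cos θx))

/-- The matrix `K_τ + h⁻² β(θ_x) M_τ` that is inverted in the smoother symbol. -/
def blockSymbol {p : ℕ} (ψ : Module.Basis (Fin (p + 1)) ℝ (Polynomial.degreeLT ℝ (p + 1)))
    (τ h : ℝ) (n : ℤ) (θx : ℝ) : Matrix (Fin (p + 1)) (Fin (p + 1)) ℝ :=
  timeStiffness ψ τ n + ((h ^ 2)⁻¹ * beta θx) • timeMass ψ τ n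

/-- The Fourier symbol of the damped block Jacobi smoother,
`(1 - ω) I + ω e^{-i θ_t} (K_τ + h⁻² β(θ_x) M_τ)⁻¹ N_τ`. -/
def smootherSymbol {p : ℕ}
    (ψ : Module.Basis (Fin (p + 1)) ℝ (Polynomial.degreeLT ℝ (p + 1)))
    (τ h : ℝ) (n : ℤ) (ω θx θt : ℝ) : Matrix (Fin (p + 1)) (Fin (p + 1)) ℂ :=
  (1 - (ω : ℂ)) • (1 : Matrix (Fin (p + 1)) (Fin (p + 1)) ℂ)
    + ((ω : ℂ) * Complex.exp (-(Complex.I * (θt : ℂ)))) •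
      (((blockSymbol ψ τ h n θx).map Complex.ofReal)⁻¹
        * (timeCoupling ψ τ n).map Complex.ofReal)

/-- `P / Q` is the `(m, n)` Padé approximation of the exponential function, normalized by
`Q(0) = 1`: `deg P ≤ m`, `deg Q ≤ n` and `e^z Q(z) - P(z) = O(z^{m+n+1})` as `z → 0`, the last
condition being expressed by the vanishing of the power series coefficients. -/
structure IsPadeExp (m n : ℕ) (P Q : ℝ[X]) : Prop where
  natDegree_num_le : P.natDegree ≤ m
  natDegree_den_le : Q.natDegree ≤ n
  den_eval_zero : Q.eval 0 = 1
  order : (PowerSeries.X : PowerSeries ℝ) ^ (m + n + 1) ∣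
    PowerSeries.exp ℝ * (Q : PowerSeries ℝ) - (P : PowerSeries ℝ)

/-- `(1 - ω)² + 2 ω (1 - ω) α cos θ_t + α² ω²`. -/
def smoothingSq (ω α θt : ℝ) : ℝ :=
  (1 - ω) ^ 2 + 2 * ω * (1 - ω) * α * Real.cos θt + α ^ 2 * ω ^ 2

/-- The nonnegative function `Ŝ(ω, α, θ_t)` whose square is `smoothingSq ω α θ_t`. -/
def smoothingFun (ω α θt : ℝ) : ℝ := Real.sqrt (smoothingSq ω α θt)

end SpaceTimeMG

end

/-! In the variable `x = t/τ` the coupling matrix is the product of the vectors of initial and final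
values of the basis. The symbol is therefore `(1-ω)I` plus a rank one matrix
(`mem_spectrum_smul_one_add_vecMulVec`): its eigenvalues are `1-ω`, present only for `p ≥ 1`, and
`1-ω+ωe^{-iθ_t}r`. Here `r = u(1)`, where `u` is the discontinuous Galerkin step for `u' = zu`, `z =
-μβ ≤ 0`, with initial value `1`. It remains to see that `u(1) = R(z)` (`eval_one_eq_of_dgForm_eq`).

Let `s` represent evaluation at `1` in `L²(0,1)` on degree at most `p`. The test function `φ =
∑_{k≤p} (-1)^k s^{(k)} z^{p-k}` satisfies `zφ + φ' = z^{p+1}s`. Testing with it gives `u(1) D(z) =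
N(z)` with `D = z^{p+1} - φ(1)` and `N = -φ(0)`. Repeated integration by parts gives `e^z D - N =
z^{p+1}(e^z - ∫₀¹ s e^{zx} dx)`, and the bracket is `O(z^{p+1})` because `s` reproduces the value at
`1` of `x^i` for `i ≤ p` (`pow_dvd_exp_mul_padeDen_sub`). Uniqueness (`padeExp_eq_zero`) identifies
`N/D` with `R`. Nondegeneracy of the Galerkin form for `z ≤ 0` yields both invertibility of the
block and `D(z) ≠ 0`. -/

namespace SpaceTimeMG

open Polynomial

/-! ### Uniqueness of the Padé approximation -/

/-- If `deg Q < a`, `deg P < b` and `e^z Q(z) - P(z) = O(z^{a+b})`, then `P = Q = 0`. -/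
theorem eq_zero_of_pow_dvd_exp_mul_sub (a b : ℕ) (P Q : ℝ[X]) (hQ : Q.degree < a)
    (hP : P.degree < b)
    (h : (PowerSeries.X : PowerSeries ℝ) ^ (a + b) ∣
      PowerSeries.exp ℝ * (Q : PowerSeries ℝ) - (P : PowerSeries ℝ)) : P = 0 ∧ Q = 0 := by
  have small : ∀ (c : ℕ) (R : ℝ[X]), R.degree < c →
      (PowerSeries.X : PowerSeries ℝ) ^ c ∣ (R : PowerSeries ℝ) → R = 0 := by
    intro c R hR hd
    rw [PowerSeries.X_pow_dvd_iff] at hd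
    ext i
    by_cases hi : i < c
    · simpa using hd i hi
    · exact coeff_eq_zero_of_degree_lt (hR.trans_le (by exact_mod_cast not_lt.1 hi))
  -- Differentiating turns `e^z Q - P` into `e^z (Q + Q') - P'`: the order and the bound on `deg P`
  -- drop by one, the bound on `deg Q` stays.
  induction b generalizing P Q with
  | zero =>
    have hP0 : P = 0 := by simpa using hP
    refine ⟨hP0, small a Q hQ ?_⟩
    subst hP0
    simp only [add_zero, coe_zero, sub_zero] at h
    exact (PowerSeries.isUnit_exp ℝ).dvd_mul_left.1 h
  | succ b ih =>
    have h' : (PowerSeries.X : PowerSeries ℝ) ^ (a + b) ∣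
        PowerSeries.exp ℝ * ((Q + derivative Q : ℝ[X]) : PowerSeries ℝ)
          - (derivative P : ℝ[X]) := by
      have e : PowerSeries.exp ℝ * ((Q + derivative Q : ℝ[X]) : PowerSeries ℝ)
          - (derivative P : ℝ[X])
          = PowerSeries.derivative ℝ (PowerSeries.exp ℝ * (Q : PowerSeries ℝ) - P) := by
        rw [map_sub, Derivation.leibniz, PowerSeries.derivative_coe, PowerSeries.derivative_coe,
          PowerSeries.derivative_exp, coe_add]
        simp only [smul_eq_mul]
        ring
      rw [e, PowerSeries.X_pow_dvd_iff]
      intro i hi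
      rw [PowerSeries.coeff_derivative, PowerSeries.X_pow_dvd_iff.1 h (i + 1) (by omega), zero_mul]
    have hd : (derivative Q).degree < a := (degree_derivative_le).trans_lt hQ
    have hP' : (derivative P).degree < b := by
      rw [degree_lt_iff_coeff_zero] at hP ⊢
      intro m hm
      rw [coeff_derivative, hP (m + 1) (by omega), zero_mul]
    obtain ⟨h1, h2⟩ := ih (derivative P) (Q + derivative Q)
      ((degree_add_le _ _).trans_lt (max_lt hQ hd)) hP' h'
    -- `Q' = -Q` is impossible for `Q ≠ 0`, since differentiation lowers the degree.
    have hQ0 : Q = 0 := by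
      by_contra hne
      have := degree_derivative_lt hne
      have e : derivative Q = -Q := eq_neg_of_add_eq_zero_right h2
      simp [e] at this
    subst hQ0
    refine ⟨small (b + 1) P hP ?_, rfl⟩
    simp only [coe_zero, mul_zero, zero_sub, dvd_neg] at h
    exact (pow_dvd_pow _ (by omega)).trans h

/-- A pair that satisfies the Padé order condition for the exponential function, and whose
denominator vanishes at `0`, is zero. -/
theorem padeExp_eq_zero (m n : ℕ) (P Q : ℝ[X]) (hP : P.natDegree ≤ m) (hQ : Q.natDegree ≤ n)
    (h0 : Q.eval 0 = 0)
    (h : (PowerSeries.X : PowerSeries ℝ) ^ (m + n + 1) ∣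
      PowerSeries.exp ℝ * (Q : PowerSeries ℝ) - (P : PowerSeries ℝ)) : P = 0 ∧ Q = 0 := by
  have hQ0 : Q.coeff 0 = 0 := by rwa [coeff_zero_eq_eval_zero]
  have hP0 : P.coeff 0 = 0 := by
    have := PowerSeries.X_pow_dvd_iff.1 h 0 (by omega)
    simpa [PowerSeries.coeff_mul, hQ0] using this
  -- Both constant terms vanish, so a common factor `z` cancels; this costs one order and one degree
  -- on each side.
  obtain ⟨P', rfl⟩ := X_dvd_iff.2 hP0
  obtain ⟨Q', rfl⟩ := X_dvd_iff.2 hQ0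
  have deg : ∀ (k : ℕ) (R : ℝ[X]), (X * R).natDegree ≤ k → R.degree < k := by
    intro k R hR
    rw [degree_lt_iff_coeff_zero]
    intro i hi
    rw [← coeff_X_mul]
    exact coeff_eq_zero_of_natDegree_lt (by omega)
  have h' : (PowerSeries.X : PowerSeries ℝ) ^ (n + m) ∣
      PowerSeries.exp ℝ * (Q' : PowerSeries ℝ) - (P' : PowerSeries ℝ) := by
    rw [coe_mul, coe_mul, coe_X] at h
    rw [mul_left_comm, ← mul_sub, pow_succ', add_comm m n] at h
    exact (mul_dvd_mul_iff_left PowerSeries.X_ne_zero).1 h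
  obtain ⟨rfl, rfl⟩ := eq_zero_of_pow_dvd_exp_mul_sub n m P' Q' (deg _ _ hQ) (deg _ _ hP) h'
  simp

theorem IsPadeExp.unique {m n : ℕ} {P Q P' Q' : ℝ[X]} (h : IsPadeExp m n P Q)
    (h' : IsPadeExp m n P' Q') : P = P' ∧ Q = Q' := by
  have := padeExp_eq_zero m n (P - P') (Q - Q')
    ((natDegree_sub_le _ _).trans (max_le h.natDegree_num_le h'.natDegree_num_le))
    ((natDegree_sub_le _ _).trans (max_le h.natDegree_den_le h'.natDegree_den_le))
    (by simp [h.den_eval_zero, h'.den_eval_zero])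
    (by
      have := dvd_sub h.order h'.order
      convert this using 1
      rw [coe_sub, coe_sub]
      ring)
  exact ⟨sub_eq_zero.1 this.1, sub_eq_zero.1 this.2⟩

/-! ### Moments on the unit interval and repeated integration by parts -/

/-- The integral over the unit interval, as a linear functional on polynomials. -/
noncomputable def unitIntegral : ℝ[X] →ₗ[ℝ] ℝ where
  toFun f := ∫ x in (0 : ℝ)..1, f.eval x
  map_add' f g := by
    simp only [eval_add]
    exact intervalIntegral.integral_add (f.continuous.intervalIntegrable _ _)
      (g.continuous.intervalIntegrable _ _)
  map_smul' c f := by simp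

theorem unitIntegral_derivative (f : ℝ[X]) :
    unitIntegral (derivative f) = f.eval 1 - f.eval 0 :=
  intervalIntegral.integral_eq_sub_of_hasDerivAt (fun x _ => f.hasDerivAt x)
    ((derivative f).continuous.intervalIntegrable _ _)

theorem unitIntegral_mul_derivative (f g : ℝ[X]) :
    unitIntegral (f * derivative g)
      = f.eval 1 * g.eval 1 - f.eval 0 * g.eval 0 - unitIntegral (derivative f * g) := by
  have := unitIntegral_derivative (f * g)
  rw [derivative_mul, map_add, eval_mul, eval_mul] at this
  linarith

theorem unitIntegral_mul_self_nonneg (f : ℝ[X]) : 0 ≤ unitIntegral (f * f) :=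
  intervalIntegral.integral_nonneg zero_le_one fun x _ => by
    simpa using mul_self_nonneg (f.eval x)

theorem eq_zero_of_unitIntegral_mul_self {f : ℝ[X]} (h : unitIntegral (f * f) = 0) : f = 0 := by
  by_contra hf
  obtain ⟨c, hc, hr⟩ := (Set.Icc_infinite (zero_lt_one (α := ℝ))).exists_notMem_finset
    f.roots.toFinset
  have hfc : f.eval c ≠ 0 := fun h0 => hr (by simp [hf, h0])
  have : 0 < unitIntegral (f * f) :=
    intervalIntegral.integral_pos zero_lt_one (f * f).continuous.continuousOn
      (fun x _ => by simpa using mul_self_nonneg (f.eval x))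
      ⟨c, hc, by simpa using mul_self_pos.2 hfc⟩
  exact this.ne' h

/-- The exponential generating function of the moments of `f` on the unit interval, that is, the
Taylor series of `z ↦ ∫₀¹ f(x) e^{zx} dx`. -/
noncomputable def momentSeries (f : ℝ[X]) : PowerSeries ℝ :=
  PowerSeries.mk fun i => unitIntegral (f * X ^ i) / i.factorial

/-- One integration by parts in `z ∫₀¹ f e^{zx} dx`, carried out coefficient by coefficient. -/
theorem X_mul_momentSeries (f : ℝ[X]) :
    PowerSeries.X * momentSeries f = PowerSeries.exp ℝ * PowerSeries.C (f.eval 1)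
      - PowerSeries.C (f.eval 0) - momentSeries (derivative f) := by
  ext i
  cases i with
  | zero =>
    simp [momentSeries, unitIntegral_derivative]
  | succ i =>
    have := unitIntegral_mul_derivative f (X ^ (i + 1))
    have e : f * derivative (X ^ (i + 1) : ℝ[X]) = ((i : ℝ) + 1) • (f * X ^ i) := by
      rw [derivative_X_pow_succ, smul_eq_C_mul]
      simp
      ring
    rw [e, map_smul] at this
    simp at this
    have h1 : ((i + 1).factorial : ℝ) = (i + 1) * i.factorial := by
      push_cast [Nat.factorial_succ]; ring
    have h2 : (i.factorial : ℝ) ≠ 0 := by positivity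
    have h3 : (i : ℝ) + 1 ≠ 0 := by positivity
    simp [momentSeries, PowerSeries.coeff_succ_X_mul, PowerSeries.coeff_mul_C,
      PowerSeries.coeff_exp, h1]
    field_simp
    linarith

/-- `∑_{k<m} (-1)^k f^{(k)} z^{m-1-k}`, as a polynomial in the variable of `f`. -/
noncomputable def partsTest (z : ℝ) : ℕ → ℝ[X] → ℝ[X]
  | 0, _ => 0
  | m + 1, f => C (z ^ m) * f - partsTest z m (derivative f)

/-- `∑_{k<m} (-1)^k f^{(k)}(a) z^{m-1-k}`, as a polynomial in `z`. -/
noncomputable def partsBoundary (a : ℝ) : ℕ → ℝ[X] → ℝ[X]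
  | 0, _ => 0
  | m + 1, f => C (f.eval a) * X ^ m - partsBoundary a m (derivative f)

/-- One double sum in `z` and `x`, read in either variable; this links the Padé pair to the Galerkin
test function. -/
theorem eval_partsBoundary (a z : ℝ) (m : ℕ) (f : ℝ[X]) :
    (partsBoundary a m f).eval z = (partsTest z m f).eval a := by
  induction m generalizing f with
  | zero => simp [partsBoundary, partsTest]
  | succ m ih =>
    rw [partsBoundary, partsTest, eval_sub, eval_sub, ih, eval_mul, eval_mul, eval_C, eval_C,
      eval_pow, eval_X, mul_comm]

theorem degree_partsBoundary_lt (a : ℝ) (m : ℕ) (f : ℝ[X]) :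
    (partsBoundary a m f).degree < m := by
  induction m generalizing f with
  | zero => simp [partsBoundary]
  | succ m ih =>
    refine (degree_sub_le _ _).trans_lt (max_lt ?_ ((ih _).trans (by norm_cast; omega)))
    exact (degree_C_mul_X_pow_le _ _).trans_lt (by norm_cast; omega)

theorem degree_partsTest_lt (z : ℝ) (m : ℕ) {n : ℕ} (f : ℝ[X]) (hf : f.degree < n) :
    (partsTest z m f).degree < n := by
  induction m generalizing f with
  | zero => simp [partsTest]
  | succ m ih =>
    refine (degree_sub_le _ _).trans_lt (max_lt ?_ (ih _ (degree_derivative_le.trans_lt hf)))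
    rw [← smul_eq_C_mul]
    exact (degree_smul_le _ _).trans_lt hf

/-- The alternating sum telescopes, leaving its two extreme terms. -/
theorem C_mul_partsTest_add_derivative (z : ℝ) (m : ℕ) (f : ℝ[X]) :
    C z * partsTest z m f + derivative (partsTest z m f)
      = C (z ^ m) * f - (-1) ^ m * derivative^[m] f := by
  induction m generalizing f with
  | zero => simp [partsTest]
  | succ m ih =>
    have := ih (derivative f)
    simp only [partsTest, derivative_sub, derivative_C_mul, Function.iterate_succ_apply, pow_succ,
      C_mul] at this ⊢
    linear_combination -this

theorem X_pow_mul_momentSeries (m : ℕ) (f : ℝ[X]) :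
    PowerSeries.X ^ m * momentSeries f
      = PowerSeries.exp ℝ * (partsBoundary 1 m f : PowerSeries ℝ)
        - (partsBoundary 0 m f : PowerSeries ℝ)
        + (-1) ^ m * momentSeries (derivative^[m] f) := by
  induction m generalizing f with
  | zero => simp [partsBoundary]
  | succ m ih =>
    have h1 := ih (derivative f)
    have h2 := X_mul_momentSeries f
    simp only [partsBoundary, Function.iterate_succ_apply, coe_sub, coe_mul, coe_C, coe_pow,
      coe_X]
    linear_combination PowerSeries.X ^ m * h2 - h1

end SpaceTimeMG

/-! ### The discontinuous Galerkin form and the Padé pair that it produces -/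

namespace SpaceTimeMG

open Polynomial

/-- The bilinear form of one step of the discontinuous Galerkin method for `u' = z u` on the unit
time interval. -/
noncomputable def dgForm (z : ℝ) : ℝ[X] →ₗ[ℝ] ℝ[X] →ₗ[ℝ] ℝ :=
  LinearMap.mk₂ ℝ
    (fun u v => -unitIntegral (u * derivative v) + u.eval 1 * v.eval 1 - z * unitIntegral (u * v))
    (fun u u' v => by simp only [add_mul, map_add, eval_add]; ring)
    (fun c u v => by simp only [smul_mul_assoc, map_smul, eval_smul, smul_eq_mul]; ring)
    (fun u v v' => by simp only [mul_add, map_add, eval_add]; ring)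
    (fun c u v => by
      simp only [mul_smul_comm, map_smul, eval_smul, smul_eq_mul]; ring)

theorem dgForm_apply (z : ℝ) (u v : ℝ[X]) :
    dgForm z u v
      = -unitIntegral (u * derivative v) + u.eval 1 * v.eval 1 - z * unitIntegral (u * v) := rfl

theorem unitIntegral_mul_derivative_self (u : ℝ[X]) :
    2 * unitIntegral (u * derivative u) = u.eval 1 ^ 2 - u.eval 0 ^ 2 := by
  have := unitIntegral_mul_derivative u u
  rw [mul_comm (derivative u) u] at this
  linarith

/-- The diagonal value is `(u(0)² + u(1)²)/2 - z∫u²`, a sum of nonnegative terms. As `z = 0` is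
allowed, only the end values are controlled. -/
theorem eval_eq_zero_of_dgForm_self {z : ℝ} (hz : z ≤ 0) {u : ℝ[X]} (h : dgForm z u u = 0) :
    u.eval 0 = 0 ∧ u.eval 1 = 0 := by
  rw [dgForm_apply] at h
  have h1 := unitIntegral_mul_derivative_self u
  have h2 : z * unitIntegral (u * u) ≤ 0 :=
    mul_nonpos_of_nonpos_of_nonneg hz (unitIntegral_mul_self_nonneg u)
  constructor <;> apply pow_eq_zero_iff (two_ne_zero) |>.1 <;>
    nlinarith [sq_nonneg (u.eval 0), sq_nonneg (u.eval 1)]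

theorem eq_zero_of_unitIntegral_derivative {u : ℝ[X]} (h0 : u.eval 0 = 0)
    (h : unitIntegral (derivative u * derivative u) = 0) : u = 0 := by
  have hd := eq_zero_of_unitIntegral_mul_self h
  rw [eq_C_of_derivative_eq_zero hd] at h0 ⊢
  rw [eval_C] at h0
  rw [h0, C_0]

/-- Once the end values vanish, pairing with `u'` leaves exactly `∫(u')²`. -/
theorem dgForm_eq_zero_left {z : ℝ} (hz : z ≤ 0) {u : ℝ[X]} (h : dgForm z u u = 0)
    (h' : dgForm z u (derivative u) = 0) : u = 0 := by
  obtain ⟨h0, h1⟩ := eval_eq_zero_of_dgForm_self hz h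
  have h2 := unitIntegral_mul_derivative_self u
  have h3 := unitIntegral_mul_derivative u (derivative u)
  rw [dgForm_apply] at h'
  simp only [h0, h1] at h' h2 h3
  refine eq_zero_of_unitIntegral_derivative h0 ?_
  have h4 : unitIntegral (u * derivative u) = 0 := by linarith
  rw [h4] at h'
  linarith

theorem dgForm_eq_zero_right {z : ℝ} (hz : z ≤ 0) {v : ℝ[X]} (h : dgForm z v v = 0)
    (h' : dgForm z (derivative v) v = 0) : v = 0 := by
  obtain ⟨h0, h1⟩ := eval_eq_zero_of_dgForm_self hz h
  have h2 := unitIntegral_mul_derivative_self v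
  rw [dgForm_apply, mul_comm _ v] at h'
  simp only [h0, h1] at h' h2
  refine eq_zero_of_unitIntegral_derivative h0 ?_
  have h4 : unitIntegral (v * derivative v) = 0 := by linarith
  rw [h4] at h'
  linarith

/-- Evaluation at `1` of polynomials of degree less than `n` has a reproducing kernel. -/
theorem exists_unitIntegral_mul_eq_eval_one (n : ℕ) :
    ∃ s : ℝ[X], s.degree < n ∧ ∀ u : ℝ[X], u.degree < n → unitIntegral (s * u) = u.eval 1 := by
  let T : degreeLT ℝ n →ₗ[ℝ] Module.Dual ℝ (degreeLT ℝ n) :=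
    ((LinearMap.mul ℝ ℝ[X]).compr₂ unitIntegral).domRestrict₁₂ (degreeLT ℝ n) (degreeLT ℝ n)
  -- The `L²` pairing is positive definite, hence injective into the dual, hence onto by dimension.
  have hT : Function.Injective T := by
    rw [← LinearMap.ker_eq_bot, LinearMap.ker_eq_bot']
    intro f hf
    have : unitIntegral ((f : ℝ[X]) * f) = 0 := LinearMap.congr_fun hf f
    exact Subtype.ext (eq_zero_of_unitIntegral_mul_self this)
  have : FiniteDimensional ℝ (degreeLT ℝ n) :=
    Module.Finite.equiv (degreeLTEquiv ℝ n).symm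
  obtain ⟨s, hs⟩ := (LinearMap.injective_iff_surjective_of_finrank_eq_finrank
    Subspace.dual_finrank_eq.symm).1 hT ((leval 1).domRestrict (degreeLT ℝ n))
  refine ⟨s, mem_degreeLT.1 s.2, fun u hu => ?_⟩
  exact LinearMap.congr_fun hs ⟨u, mem_degreeLT.2 hu⟩

/-- The polynomial that represents evaluation at `1` on the polynomials of degree at most `p`. -/
noncomputable def endKernel (p : ℕ) : ℝ[X] :=
  (exists_unitIntegral_mul_eq_eval_one (p + 1)).choose

theorem degree_endKernel_lt (p : ℕ) : (endKernel p).degree < ((p + 1 : ℕ) : WithBot ℕ) :=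
  (exists_unitIntegral_mul_eq_eval_one (p + 1)).choose_spec.1

theorem unitIntegral_endKernel_mul (p : ℕ) {u : ℝ[X]} (hu : u.degree < ((p + 1 : ℕ) : WithBot ℕ)) :
    unitIntegral (endKernel p * u) = u.eval 1 :=
  (exists_unitIntegral_mul_eq_eval_one (p + 1)).choose_spec.2 u hu

theorem endKernel_ne_zero (p : ℕ) : endKernel p ≠ 0 := by
  intro h
  have := unitIntegral_endKernel_mul p (u := 1)
    (degree_one_le.trans_lt (by exact_mod_cast Nat.succ_pos p))
  simp [h] at this

/-- The denominator, up to a constant, of the subdiagonal Padé approximation of `e^z`. -/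
noncomputable def padeDen (p : ℕ) : ℝ[X] :=
  X ^ (p + 1) - partsBoundary 1 (p + 1) (endKernel p)

/-- The numerator, up to a constant, of the subdiagonal Padé approximation of `e^z`. -/
noncomputable def padeNum (p : ℕ) : ℝ[X] :=
  -partsBoundary 0 (p + 1) (endKernel p)

theorem natDegree_padeNum_le (p : ℕ) : (padeNum p).natDegree ≤ p := by
  have := degree_partsBoundary_lt 0 (p + 1) (endKernel p)
  rw [padeNum, natDegree_neg]
  exact natDegree_le_iff_degree_le.2 (Order.lt_succ_iff.1 this)

theorem monic_padeDen (p : ℕ) : (padeDen p).Monic :=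
  monic_X_pow_sub (degree_partsBoundary_lt 1 (p + 1) (endKernel p))

theorem natDegree_padeDen_le (p : ℕ) : (padeDen p).natDegree ≤ p + 1 := by
  rw [natDegree_le_iff_degree_le]
  exact (degree_sub_le _ _).trans
    (max_le (degree_X_pow_le _) (degree_partsBoundary_lt 1 (p + 1) (endKernel p)).le)

theorem iterate_derivative_endKernel (p : ℕ) : derivative^[p + 1] (endKernel p) = 0 :=
  iterate_derivative_eq_zero_of_degree_lt (degree_endKernel_lt p)

theorem pow_dvd_exp_mul_padeDen_sub (p : ℕ) :
    (PowerSeries.X : PowerSeries ℝ) ^ (p + (p + 1) + 1) ∣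
      PowerSeries.exp ℝ * (padeDen p : PowerSeries ℝ) - (padeNum p : PowerSeries ℝ) := by
  have h := X_pow_mul_momentSeries (p + 1) (endKernel p)
  have h0 : momentSeries 0 = 0 := by ext; simp [momentSeries]
  rw [iterate_derivative_endKernel, h0, mul_zero, add_zero] at h
  have e : PowerSeries.exp ℝ * (padeDen p : PowerSeries ℝ) - (padeNum p : PowerSeries ℝ)
      = PowerSeries.X ^ (p + 1) * (PowerSeries.exp ℝ - momentSeries (endKernel p)) := by
    rw [mul_sub, h, padeDen, padeNum, coe_sub, coe_neg, coe_pow, coe_X]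
    ring
  rw [e, show p + (p + 1) + 1 = (p + 1) + (p + 1) by ring, pow_add]
  refine mul_dvd_mul_left _ (PowerSeries.X_pow_dvd_iff.2 fun i hi => ?_)
  have hd : (X ^ i : ℝ[X]).degree < ((p + 1 : ℕ) : WithBot ℕ) := by
    rw [degree_X_pow]; exact_mod_cast hi
  simp [momentSeries, unitIntegral_endKernel_mul p hd, PowerSeries.coeff_exp]

/-- A zero at `0` would force the whole pair to vanish, although the denominator is monic. -/
theorem eval_zero_padeDen_ne_zero (p : ℕ) : (padeDen p).eval 0 ≠ 0 := fun h =>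
  (monic_padeDen p).ne_zero (padeExp_eq_zero p (p + 1) _ _ (natDegree_padeNum_le p)
    (natDegree_padeDen_le p) h (pow_dvd_exp_mul_padeDen_sub p)).2

theorem isPadeExp_padeNum_padeDen (p : ℕ) :
    IsPadeExp p (p + 1) (C ((padeDen p).eval 0)⁻¹ * padeNum p)
      (C ((padeDen p).eval 0)⁻¹ * padeDen p) where
  natDegree_num_le := (natDegree_C_mul_le _ _).trans (natDegree_padeNum_le p)
  natDegree_den_le := (natDegree_C_mul_le _ _).trans (natDegree_padeDen_le p)
  den_eval_zero := by simp [eval_zero_padeDen_ne_zero p]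
  order := by
    rw [coe_mul, coe_mul, mul_left_comm, ← mul_sub]
    exact (pow_dvd_exp_mul_padeDen_sub p).mul_left _

theorem existsUnique_isPadeExp (p : ℕ) :
    ∃! PQ : ℝ[X] × ℝ[X], IsPadeExp p (p + 1) PQ.1 PQ.2 :=
  ⟨(_, _), isPadeExp_padeNum_padeDen p, fun _ h =>
    Prod.ext (h.unique (isPadeExp_padeNum_padeDen p)).1
      (h.unique (isPadeExp_padeNum_padeDen p)).2⟩

/-- The test function which extracts the value at the end point in the discontinuous Galerkin
equation. -/
noncomputable def endTest (p : ℕ) (z : ℝ) : ℝ[X] := partsTest z (p + 1) (endKernel p)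

theorem degree_endTest_lt (p : ℕ) (z : ℝ) : (endTest p z).degree < ((p + 1 : ℕ) : WithBot ℕ) :=
  degree_partsTest_lt z (p + 1) _ (degree_endKernel_lt p)

theorem endTest_add_derivative (p : ℕ) (z : ℝ) :
    C z * endTest p z + derivative (endTest p z) = C (z ^ (p + 1)) * endKernel p := by
  rw [endTest, C_mul_partsTest_add_derivative, iterate_derivative_endKernel, mul_zero, sub_zero]

theorem eval_zero_endTest (p : ℕ) (z : ℝ) : (endTest p z).eval 0 = -(padeNum p).eval z := by
  rw [padeNum, eval_neg, eval_partsBoundary, neg_neg, endTest]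

/-- The form integrates `u` against `-(zφ + φ') = -z^{p+1}s`, so only `u(1)` survives. -/
theorem dgForm_endTest (p : ℕ) (z : ℝ) {u : ℝ[X]} (hu : u.degree < ((p + 1 : ℕ) : WithBot ℕ)) :
    dgForm z u (endTest p z) = -(u.eval 1 * (padeDen p).eval z) := by
  have h1 := unitIntegral_endKernel_mul p hu
  have h2 : u * derivative (endTest p z)
      = z ^ (p + 1) • (endKernel p * u) - z • (u * endTest p z) := by
    rw [smul_eq_C_mul, smul_eq_C_mul]
    linear_combination u * endTest_add_derivative p z
  rw [dgForm_apply, h2, map_sub, map_smul, map_smul, h1, padeDen, eval_sub, eval_partsBoundary,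
    eval_pow, eval_X, endTest]
  simp only [smul_eq_mul]
  ring

/-- At a zero of the denominator the end test function would be annihilated by every trial function,
hence vanish. Then `z^{p+1}s = 0` with `s ≠ 0` leaves only `z = 0`, which is already excluded. -/
theorem eval_padeDen_ne_zero (p : ℕ) {z : ℝ} (hz : z ≤ 0) : (padeDen p).eval z ≠ 0 := by
  intro h
  have hφ : ∀ u : ℝ[X], u.degree < ((p + 1 : ℕ) : WithBot ℕ) → dgForm z u (endTest p z) = 0 := by
    intro u hu
    rw [dgForm_endTest p z hu, h, mul_zero, neg_zero]
  have h0 : endTest p z = 0 := dgForm_eq_zero_right hz (hφ _ (degree_endTest_lt p z))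
    (hφ _ (degree_derivative_le.trans_lt (degree_endTest_lt p z)))
  have h1 := endTest_add_derivative p z
  rw [h0, derivative_zero, mul_zero, add_zero, eq_comm, mul_eq_zero, C_eq_zero] at h1
  rcases h1 with h1 | h1
  · rw [pow_eq_zero_iff (Nat.succ_ne_zero p)] at h1
    subst h1
    exact eval_zero_padeDen_ne_zero p h
  · exact endKernel_ne_zero p h1

/-- The value at the end point of the discontinuous Galerkin solution is given by the Padé
approximation of the exponential function. -/
theorem eval_one_eq_of_dgForm_eq (p : ℕ) {z : ℝ} (hz : z ≤ 0) {u : ℝ[X]}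
    (hu : u.degree < ((p + 1 : ℕ) : WithBot ℕ))
    (h : ∀ v : ℝ[X], v.degree < ((p + 1 : ℕ) : WithBot ℕ) → dgForm z u v = v.eval 0)
    {P Q : ℝ[X]} (hPQ : IsPadeExp p (p + 1) P Q) :
    Q.eval z ≠ 0 ∧ u.eval 1 = P.eval z / Q.eval z := by
  obtain ⟨rfl, rfl⟩ := hPQ.unique (isPadeExp_padeNum_padeDen p)
  have h1 := eval_padeDen_ne_zero p hz
  have h2 := inv_ne_zero (eval_zero_padeDen_ne_zero p)
  have h3 := h _ (degree_endTest_lt p z)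
  rw [dgForm_endTest p z hu, eval_zero_endTest, neg_inj] at h3
  rw [eval_C_mul, eval_C_mul, mul_div_mul_left _ _ h2]
  exact ⟨mul_ne_zero h2 h1, eq_div_of_mul_eq h1 h3⟩

end SpaceTimeMG

/-! ### Rescaling to the unit interval and the matrices of the time step -/

namespace SpaceTimeMG

open Polynomial

/-- The rescaling `f ↦ f(τ x)`. -/
noncomputable def scaleVar (τ : ℝ) : ℝ[X] →ₗ[ℝ] ℝ[X] := (aeval (C τ * X : ℝ[X])).toLinearMap

theorem scaleVar_apply (τ : ℝ) (f : ℝ[X]) : scaleVar τ f = f.comp (C τ * X) := rfl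

theorem scaleVar_scaleVar (σ τ : ℝ) (f : ℝ[X]) :
    scaleVar σ (scaleVar τ f) = scaleVar (τ * σ) f := by
  simp only [scaleVar_apply, comp_assoc, mul_comp, C_comp, X_comp, C_mul, mul_assoc]

theorem scaleVar_one (f : ℝ[X]) : scaleVar 1 f = f := by simp [scaleVar_apply]

theorem eval_scaleVar (τ x : ℝ) (f : ℝ[X]) : (scaleVar τ f).eval x = f.eval (τ * x) := by
  simp [scaleVar_apply]

theorem derivative_scaleVar (τ : ℝ) (f : ℝ[X]) :
    derivative (scaleVar τ f) = C τ * scaleVar τ (derivative f) := by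
  simp [scaleVar_apply, derivative_comp]

theorem degree_scaleVar_lt (τ : ℝ) {f : ℝ[X]} {n : ℕ} (hf : f.degree < n) :
    (scaleVar τ f).degree < n := by
  rw [degree_lt_iff_coeff_zero] at hf ⊢
  intro m hm
  rw [scaleVar_apply, comp_C_mul_X_coeff, hf m hm, zero_mul]

section Basis

variable {p : ℕ} (ψ : Module.Basis (Fin (p + 1)) ℝ (Polynomial.degreeLT ℝ (p + 1)))

theorem degree_scaleVar_basis_lt (τ : ℝ) (k : Fin (p + 1)) :
    (scaleVar τ (ψ k)).degree < ((p + 1 : ℕ) : WithBot ℕ) :=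
  degree_scaleVar_lt τ (mem_degreeLT.1 (ψ k).2)

/-- Passes from the rows of a matrix equation to all test functions; `τ ≠ 0` makes the rescaling
invertible. -/
theorem apply_eq_zero_of_scaled_basis {τ : ℝ} (hτ : τ ≠ 0) (T : ℝ[X] →ₗ[ℝ] ℝ)
    (h : ∀ k, T (scaleVar τ (ψ k)) = 0) (f : ℝ[X])
    (hf : f.degree < ((p + 1 : ℕ) : WithBot ℕ)) : T f = 0 := by
  have h0 : T ∘ₗ scaleVar τ ∘ₗ (degreeLT ℝ (p + 1)).subtype = 0 := ψ.ext fun k => by simp [h k]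
  have := LinearMap.congr_fun h0 ⟨scaleVar τ⁻¹ f, mem_degreeLT.2 (degree_scaleVar_lt _ hf)⟩
  simpa [scaleVar_scaleVar, inv_mul_cancel₀ hτ, scaleVar_one] using this

theorem eq_zero_of_sum_scaled_basis {τ : ℝ} (hτ : τ ≠ 0) (c : Fin (p + 1) → ℝ)
    (h : ∑ k, c k • scaleVar τ (ψ k) = 0) : c = 0 := by
  have h1 := congrArg (scaleVar τ⁻¹) h
  simp only [map_sum, map_smul, scaleVar_scaleVar, mul_inv_cancel₀ hτ, scaleVar_one,
    map_zero] at h1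
  have h2 : ∑ k, c k • ψ k = 0 := by
    apply Subtype.ext
    simpa using h1
  exact funext (Fintype.linearIndependent_iff.1 ψ.linearIndependent c h2)

theorem degree_sum_scaled_basis_lt (τ : ℝ) (c : Fin (p + 1) → ℝ) :
    (∑ k, c k • scaleVar τ (ψ k)).degree < ((p + 1 : ℕ) : WithBot ℕ) :=
  mem_degreeLT.1 (Submodule.sum_mem _ fun k _ =>
    Submodule.smul_mem _ _ (mem_degreeLT.2 (degree_scaleVar_basis_lt ψ τ k)))

theorem node_sub_node (τ : ℝ) (n : ℤ) : node τ n - node τ (n - 1) = τ := by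
  simp only [node]; push_cast; ring

theorem timeBasis_affine (τ : ℝ) (n : ℤ) (k : Fin (p + 1)) (x : ℝ) :
    timeBasis ψ τ n k (τ * x + node τ (n - 1)) = (scaleVar τ (ψ k)).eval x := by
  rw [timeBasis, eval_scaleVar, add_sub_cancel_right]

theorem timeBasis_node (τ : ℝ) (n : ℤ) (k : Fin (p + 1)) :
    timeBasis ψ τ n k (node τ n) = (scaleVar τ (ψ k)).eval 1 := by
  rw [timeBasis, eval_scaleVar, node_sub_node, mul_one]

theorem timeBasis_node_sub_one (τ : ℝ) (n : ℤ) (k : Fin (p + 1)) :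
    timeBasis ψ τ n k (node τ (n - 1)) = (scaleVar τ (ψ k)).eval 0 := by
  rw [timeBasis, eval_scaleVar, sub_self, mul_zero]

theorem mul_deriv_timeBasis_affine (τ : ℝ) (n : ℤ) (k : Fin (p + 1)) (x : ℝ) :
    τ * deriv (timeBasis ψ τ n k) (τ * x + node τ (n - 1))
      = (derivative (scaleVar τ (ψ k))).eval x := by
  have h : HasDerivAt (timeBasis ψ τ n k)
      ((derivative (ψ k : ℝ[X])).eval (τ * x + node τ (n - 1) - node τ (n - 1)))
      (τ * x + node τ (n - 1)) :=
    ((ψ k : ℝ[X]).hasDerivAt _).comp_sub_const _ _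
  rw [h.deriv, derivative_scaleVar, eval_C_mul, eval_scaleVar, add_sub_cancel_right]

theorem integral_node (τ : ℝ) (n : ℤ) (f : ℝ → ℝ) :
    ∫ t in (node τ (n - 1))..(node τ n), f t
      = ∫ x in (0 : ℝ)..1, τ * f (τ * x + node τ (n - 1)) := by
  have := intervalIntegral.smul_integral_comp_mul_add (a := 0) (b := 1) f τ (node τ (n - 1))
  rw [mul_zero, zero_add, mul_one, ← sub_eq_iff_eq_add.1 (node_sub_node τ n)] at this
  rw [← this, intervalIntegral.integral_const_mul, smul_eq_mul]

theorem timeStiffness_apply (τ : ℝ) (n : ℤ) (k l : Fin (p + 1)) :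
    timeStiffness ψ τ n k l
      = -unitIntegral (scaleVar τ (ψ l) * derivative (scaleVar τ (ψ k)))
        + (scaleVar τ (ψ l)).eval 1 * (scaleVar τ (ψ k)).eval 1 := by
  simp only [timeStiffness, Matrix.of_apply, timeBasis_node, integral_node,
    mul_left_comm τ, timeBasis_affine, mul_deriv_timeBasis_affine, ← eval_mul]
  rfl

theorem timeMass_apply (τ : ℝ) (n : ℤ) (k l : Fin (p + 1)) :
    timeMass ψ τ n k l = τ * unitIntegral (scaleVar τ (ψ l) * scaleVar τ (ψ k)) := by
  simp only [timeMass, Matrix.of_apply, integral_node, timeBasis_affine, ← eval_mul,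
    intervalIntegral.integral_const_mul]
  rfl

/-- The coupling has rank one: on the previous interval the node `t_{n-1}` is the right end point,
on the current one the left. -/
theorem timeCoupling_eq (τ : ℝ) (n : ℤ) :
    timeCoupling ψ τ n = Matrix.vecMulVec (fun k => (scaleVar τ (ψ k)).eval 0)
      (fun l => (scaleVar τ (ψ l)).eval 1) := by
  ext k l
  rw [timeCoupling, Matrix.of_apply, timeBasis_node, timeBasis_node_sub_one, Matrix.vecMulVec_apply,
    mul_comm]

theorem blockSymbol_apply (τ h : ℝ) (n : ℤ) (θx : ℝ) (k l : Fin (p + 1)) :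
    blockSymbol ψ τ h n θx k l
      = dgForm (-(τ * (h ^ 2)⁻¹ * beta θx)) (scaleVar τ (ψ l)) (scaleVar τ (ψ k)) := by
  rw [blockSymbol, Matrix.add_apply, Matrix.smul_apply, timeStiffness_apply, timeMass_apply,
    dgForm_apply, smul_eq_mul]
  ring

theorem blockSymbol_mulVec (τ h : ℝ) (n : ℤ) (θx : ℝ) (c : Fin (p + 1) → ℝ) (k : Fin (p + 1)) :
    (blockSymbol ψ τ h n θx).mulVec c k
      = dgForm (-(τ * (h ^ 2)⁻¹ * beta θx)) (∑ l, c l • scaleVar τ (ψ l)) (scaleVar τ (ψ k)) := by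
  simp only [Matrix.mulVec, dotProduct, blockSymbol_apply, map_sum, map_smul,
    LinearMap.sum_apply, LinearMap.smul_apply, smul_eq_mul, mul_comm]

theorem beta_nonneg (θx : ℝ) : 0 ≤ beta θx := by
  have h1 := Real.cos_le_one θx
  have h2 := Real.neg_one_le_cos θx
  exact mul_nonneg (by norm_num) (div_nonneg (by linarith) (by linarith))

theorem neg_scaled_beta_nonpos {τ : ℝ} (hτ : 0 < τ) (h θx : ℝ) :
    -(τ * (h ^ 2)⁻¹ * beta θx) ≤ 0 :=
  neg_nonpos.2 (mul_nonneg (mul_nonneg hτ.le (inv_nonneg.2 (sq_nonneg h))) (beta_nonneg θx))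

/-- A kernel vector gives a trial polynomial annihilating all test functions, in particular itself
and its derivative. -/
theorem isUnit_det_blockSymbol {τ : ℝ} (hτ : 0 < τ) (h : ℝ) (n : ℤ) (θx : ℝ) :
    IsUnit (blockSymbol ψ τ h n θx).det := by
  rw [isUnit_iff_ne_zero]
  intro hdet
  obtain ⟨c, hc, h0⟩ := Matrix.exists_mulVec_eq_zero_iff.2 hdet
  have hv := apply_eq_zero_of_scaled_basis ψ hτ.ne' (dgForm (-(τ * (h ^ 2)⁻¹ * beta θx))
    (∑ l, c l • scaleVar τ (ψ l))) fun k => by rw [← blockSymbol_mulVec ψ τ h n, h0, Pi.zero_apply]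
  have hd := degree_sum_scaled_basis_lt ψ τ c
  exact hc (eq_zero_of_sum_scaled_basis ψ hτ.ne' c (dgForm_eq_zero_left
    (neg_scaled_beta_nonpos hτ h θx) (hv _ hd) (hv _ (degree_derivative_le.trans_lt hd))))

/-- The nonzero eigenvalue of the rank one matrix `(K_τ + h⁻² β M_τ)⁻¹ N_τ` is the stability
function of the Padé approximation. -/
theorem inv_blockSymbol_mulVec_dotProduct {τ : ℝ} (hτ : 0 < τ) (h : ℝ) (n : ℤ) (θx : ℝ)
    {P Q : ℝ[X]} (hPQ : IsPadeExp p (p + 1) P Q) :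
    Q.eval (-(τ * (h ^ 2)⁻¹ * beta θx)) ≠ 0 ∧
    (blockSymbol ψ τ h n θx)⁻¹.mulVec (fun k => (scaleVar τ (ψ k)).eval 0)
        ⬝ᵥ (fun l => (scaleVar τ (ψ l)).eval 1)
      = P.eval (-(τ * (h ^ 2)⁻¹ * beta θx)) / Q.eval (-(τ * (h ^ 2)⁻¹ * beta θx)) := by
  set c := (blockSymbol ψ τ h n θx)⁻¹.mulVec (fun k => (scaleVar τ (ψ k)).eval 0) with hc
  have hA : (blockSymbol ψ τ h n θx).mulVec c = fun k => (scaleVar τ (ψ k)).eval 0 := by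
    rw [hc, Matrix.mulVec_mulVec, Matrix.mul_nonsing_inv _ (isUnit_det_blockSymbol ψ hτ h n θx),
      Matrix.one_mulVec]
  -- The linear system for `c` is the Galerkin equation with initial value `1`; the dot product then
  -- reads off its end value.
  have hv : ∀ v : ℝ[X], v.degree < ((p + 1 : ℕ) : WithBot ℕ) →
      dgForm (-(τ * (h ^ 2)⁻¹ * beta θx)) (∑ l, c l • scaleVar τ (ψ l)) v = v.eval 0 := by
    intro v hv
    have := apply_eq_zero_of_scaled_basis ψ hτ.ne' (dgForm (-(τ * (h ^ 2)⁻¹ * beta θx))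
      (∑ l, c l • scaleVar τ (ψ l)) - leval 0) (fun k => by
        rw [LinearMap.sub_apply, ← blockSymbol_mulVec ψ τ h n, hA]
        exact sub_self _) v hv
    exact sub_eq_zero.1 this
  have key := eval_one_eq_of_dgForm_eq p (neg_scaled_beta_nonpos hτ h θx)
    (degree_sum_scaled_basis_lt ψ τ c) hv hPQ
  refine ⟨key.1, key.2 ▸ ?_⟩
  simp [dotProduct, eval_finsetSum]

end Basis

/-! ### Spectrum of the symbol -/

/-- The spectrum of a rank one perturbation of a multiple of the identity matrix. -/
theorem mem_spectrum_smul_one_add_vecMulVec {K : Type*} [Field K] {m : ℕ} (a z : K)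
    (u v : Fin (m + 1) → K) :
    z ∈ spectrum K (a • (1 : Matrix (Fin (m + 1)) (Fin (m + 1)) K) + Matrix.vecMulVec u v) ↔
      (z = a ∧ 1 ≤ m) ∨ z = a + u ⬝ᵥ v := by
  have e : z ∈ spectrum K (a • (1 : Matrix (Fin (m + 1)) (Fin (m + 1)) K) + Matrix.vecMulVec u v)
      ↔ z - a ∈ spectrum K (Matrix.vecMulVec u v) := by
    rw [← Algebra.algebraMap_eq_smul_one, spectrum.mem_iff, spectrum.mem_iff, map_sub, sub_sub]
  -- The size is `m + 1`, so the factor `(z - a)^m` contributes a root only when `m ≥ 1`.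
  have f : ((z - a) ^ (m + 1) - u ⬝ᵥ v * (z - a) ^ m : K) = (z - a) ^ m * (z - (a + u ⬝ᵥ v)) := by
    ring
  rw [e, Matrix.mem_spectrum_iff_isRoot_charpoly, Matrix.charpoly_vecMulVec, IsRoot.def]
  simp only [Fintype.card_fin, Nat.add_sub_cancel, eval_sub, eval_pow, eval_X, eval_smul,
    smul_eq_mul, f, mul_eq_zero, pow_eq_zero_iff', sub_eq_zero, Nat.one_le_iff_ne_zero]

/-- Expanding the modulus with `sin² + cos² = 1`; in particular the quantity under the square root
is nonnegative. -/
theorem smoothingSq_eq (ω α θt : ℝ) :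
    smoothingSq ω α θt = ‖(1 - (ω : ℂ)) + ω * Complex.exp (-(Complex.I * θt)) * α‖ ^ 2 := by
  have h1 : Complex.exp (-(Complex.I * θt)) = (Real.cos θt : ℂ) - Real.sin θt * Complex.I := by
    rw [show -(Complex.I * θt) = ((-θt : ℝ) : ℂ) * Complex.I by push_cast; ring,
      Complex.exp_mul_I, ← Complex.ofReal_cos, ← Complex.ofReal_sin, Real.cos_neg, Real.sin_neg]
    push_cast
    ring
  have h2 := Real.sin_sq_add_cos_sq θt
  rw [h1, Complex.sq_norm, Complex.normSq_apply, smoothingSq]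
  generalize Real.cos θt = c at *
  generalize Real.sin θt = s at *
  simp
  linear_combination -(ω ^ 2 * α ^ 2) * h2

theorem smoothingFun_eq (ω α θt : ℝ) :
    smoothingFun ω α θt = ‖(1 - (ω : ℂ)) + ω * Complex.exp (-(Complex.I * θt)) * α‖ := by
  rw [smoothingFun, smoothingSq_eq, Real.sqrt_sq (norm_nonneg _)]

theorem smootherSymbol_eq {p : ℕ}
    (ψ : Module.Basis (Fin (p + 1)) ℝ (Polynomial.degreeLT ℝ (p + 1)))
    {τ : ℝ} (hτ : 0 < τ) (h : ℝ) (n : ℤ) (ω θx θt : ℝ) :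
    smootherSymbol ψ τ h n ω θx θt = (1 - (ω : ℂ)) • 1 + Matrix.vecMulVec
      (((ω : ℂ) * Complex.exp (-(Complex.I * (θt : ℂ)))) • (Complex.ofReal ∘
        (blockSymbol ψ τ h n θx)⁻¹.mulVec (fun k => (scaleVar τ (ψ k)).eval 0)))
      (Complex.ofReal ∘ fun l => (scaleVar τ (ψ l)).eval 1) := by
  have hinv : ((blockSymbol ψ τ h n θx).map Complex.ofReal)⁻¹
      = (blockSymbol ψ τ h n θx)⁻¹.map Complex.ofReal := by
    apply Matrix.inv_eq_right_inv
    have := congrArg (fun A => A.map Complex.ofRealHom)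
      (Matrix.mul_nonsing_inv _ (isUnit_det_blockSymbol ψ hτ h n θx))
    rw [Matrix.map_mul, Matrix.map_one _ (map_zero _) (map_one _)] at this
    exact this
  rw [smootherSymbol, hinv, timeCoupling_eq, Matrix.smul_vecMulVec]
  congr 2
  have := congrArg (fun A => A.map Complex.ofRealHom) (Matrix.mul_vecMulVec
    (blockSymbol ψ τ h n θx)⁻¹ (fun k => (scaleVar τ (ψ k)).eval 0)
    (fun l => (scaleVar τ (ψ l)).eval 1))
  rw [Matrix.map_mul] at this
  refine this.trans ?_
  ext k l
  simp [Matrix.vecMulVec_apply]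

theorem mem_spectrum_smootherSymbol {p : ℕ}
    (ψ : Module.Basis (Fin (p + 1)) ℝ (Polynomial.degreeLT ℝ (p + 1)))
    {τ : ℝ} (hτ : 0 < τ) (h : ℝ) (n : ℤ) (ω θx θt : ℝ)
    {P Q : ℝ[X]} (hPQ : IsPadeExp p (p + 1) P Q) (z : ℂ) :
    z ∈ spectrum ℂ (smootherSymbol ψ τ h n ω θx θt) ↔ (z = 1 - (ω : ℂ) ∧ 1 ≤ p) ∨
      z = (1 - (ω : ℂ)) + ω * Complex.exp (-(Complex.I * θt)) *
        ((P.eval (-(τ * (h ^ 2)⁻¹ * beta θx)) / Q.eval (-(τ * (h ^ 2)⁻¹ * beta θx)) : ℝ) : ℂ) := by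
  rw [smootherSymbol_eq ψ hτ, mem_spectrum_smul_one_add_vecMulVec, smul_dotProduct,
    ← (inv_blockSymbol_mulVec_dotProduct ψ hτ h n θx hPQ).2, smul_eq_mul]
  simp [dotProduct]

end SpaceTimeMG

theorem mainTheorem6 (p : ℕ)
    (ψ : Module.Basis (Fin (p + 1)) ℝ (Polynomial.degreeLT ℝ (p + 1)))
    (τ h : ℝ) (hτ : 0 < τ) (hh : 0 < h) (n : ℤ) (ω θx θt : ℝ) :
    -- the Padé approximation exists, and its normalized numerator and denominator are unique
    (∃! PQ : Polynomial ℝ × Polynomial ℝ, SpaceTimeMG.IsPadeExp p (p + 1) PQ.1 PQ.2) ∧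
    ∀ P Q : Polynomial ℝ, SpaceTimeMG.IsPadeExp p (p + 1) P Q →
      ∀ μ α : ℝ, μ = τ * (h ^ 2)⁻¹ →
        α = P.eval (-(μ * SpaceTimeMG.beta θx)) / Q.eval (-(μ * SpaceTimeMG.beta θx)) →
        -- all the expressions are well defined
        IsUnit (SpaceTimeMG.blockSymbol ψ τ h n θx).det ∧
        Q.eval (-(μ * SpaceTimeMG.beta θx)) ≠ 0 ∧
        SpaceTimeMG.smoothingFun ω α θt ^ 2 = SpaceTimeMG.smoothingSq ω α θt ∧
        -- the spectral radius
        (1 ≤ p → spectralRadius ℂ (SpaceTimeMG.smootherSymbol ψ τ h n ω θx θt)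
          = ENNReal.ofReal (max |1 - ω| (SpaceTimeMG.smoothingFun ω α θt))) ∧
        (p = 0 → spectralRadius ℂ (SpaceTimeMG.smootherSymbol ψ τ h n ω θx θt)
          = ENNReal.ofReal (SpaceTimeMG.smoothingFun ω α θt)) := by
  refine ⟨SpaceTimeMG.existsUnique_isPadeExp p, fun P Q hPQ μ α hμ hα => ?_⟩
  subst hμ hα
  have hmem := SpaceTimeMG.mem_spectrum_smootherSymbol ψ hτ h n ω θx θt hPQ
  refine ⟨SpaceTimeMG.isUnit_det_blockSymbol ψ hτ h n θx,
    (SpaceTimeMG.inv_blockSymbol_mulVec_dotProduct ψ hτ h n θx hPQ).1, ?_, ?_, ?_⟩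
  · rw [SpaceTimeMG.smoothingFun_eq, SpaceTimeMG.smoothingSq_eq]
  · intro hp
    have hω : |1 - ω| = ‖1 - (ω : ℂ)‖ := by
      rw [← Complex.ofReal_one, ← Complex.ofReal_sub, Complex.norm_real, Real.norm_eq_abs]
    have hs : spectrum ℂ (SpaceTimeMG.smootherSymbol ψ τ h n ω θx θt) = {1 - (ω : ℂ), _} :=
      Set.ext fun z => (hmem z).trans (by rw [and_iff_left hp]; exact Iff.rfl)
    rw [spectralRadius, hs, iSup_pair, SpaceTimeMG.smoothingFun_eq, hω, ENNReal.ofReal_max,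
      ofReal_norm, ofReal_norm]
    rfl
  · intro hp
    have hs : spectrum ℂ (SpaceTimeMG.smootherSymbol ψ τ h n ω θx θt) = {_} :=
      Set.ext fun z => (hmem z).trans (or_iff_right fun hz => by omega)
    rw [spectralRadius, hs, iSup_singleton, SpaceTimeMG.smoothingFun_eq, ofReal_norm]
    rfl
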